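/- A strict plane partition of shape $\lambda=(\lambda_1\ge\lambda_2\ge\dots\ge\lambda_r\ge 1)$ is an array $\pi=(\pi_{i,j})_{1\le i\le r,\,1\le j\le\lambda_i}$ of non-negative integers (its parts) whose rows are weakly decreasing and whose columns are strictly decreasing; its number of columns is $\lambda_1$, and its norm $n(\pi)$ is the sum of its parts. The empty array ($r=0$, no columns, norm $0$) is included. Let $n,c\ge 0$ be integers. Then there are only finitely many strict plane partitions, of any shape, with all parts in $\{1,2,\dots,n\}$ and at most $c$ columns, and their generating function is $$\sum_{\pi} q^{n(\pi)}=\prod_{i=1}^{n}\frac{[c+i;q]_i}{[i;q]_i},$$ an identity of rational functions in the indeterminate $q$ over $\mathbb{Q}$, where $[m;q]=1+q+\dots+q^{m-1}$ and $[a;q]_m=\prod_{j=0}^{m-1}[a+j;q]$. -/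

import Mathlib

/-- A strict plane partition: a filling of the cells of a Young diagram (the shape `λ`, whose
`i`-th row has `λ_i` cells, rows and columns being indexed from `0`) by non-negative integers,
weakly decreasing along rows and strictly decreasing down columns. The entry is set to `0` outside
the shape, so that a strict plane partition is determined by its shape and its entries there. -/
@[ext]
structure StrictPlanePartition where
  shape : YoungDiagram
  entry : ℕ → ℕ → ℕ
  row_weak : ∀ {i j₁ j₂ : ℕ}, j₁ < j₂ → (i, j₂) ∈ shape → entry i j₂ ≤ entry i j₁
  col_strict : ∀ {i₁ i₂ j : ℕ}, i₁ < i₂ → (i₂, j) ∈ shape → entry i₂ j < entry i₁ j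
  zeros : ∀ {i j : ℕ}, (i, j) ∉ shape → entry i j = 0

namespace StrictPlanePartition

/-- The norm `n(π)`: the sum of the parts of `π`. -/
def norm (π : StrictPlanePartition) : ℕ :=
  ∑ x ∈ π.shape.cells, π.entry x.1 x.2

/-- The number of columns of `π`, that is, the length of the first row of its shape. -/
def numCols (π : StrictPlanePartition) : ℕ :=
  π.shape.rowLen 0

/-- All parts of `π` lie in `{1, 2, …, n}`. -/
def PartsIn (π : StrictPlanePartition) (n : ℕ) : Prop :=
  ∀ i j : ℕ, (i, j) ∈ π.shape → 1 ≤ π.entry i j ∧ π.entry i j ≤ n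

/-- The strict plane partitions with parts in `{1, 2, …, n}` and at most `c` columns. -/
def bounded (n c : ℕ) : Set StrictPlanePartition :=
  {π | π.PartsIn n ∧ π.numCols ≤ c}

end StrictPlanePartition

/-- `[m;q] = 1 + q + ⋯ + q^(m-1)`. -/
def qBracket {K : Type*} [Field K] (q : K) (m : ℕ) : K :=
  ∑ i ∈ Finset.range m, q ^ i

/-- `[a;q]_m = [a;q] [a+1;q] ⋯ [a+m-1;q]`. -/
def qRising {K : Type*} [Field K] (q : K) (a m : ℕ) : K :=
  ∏ i ∈ Finset.range m, qBracket q (a + i)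

/-! Grouped by shape, strict plane partitions are counted by Schur functions at `q, …, q^n`; the sum
over shapes is a bounded Littlewood identity.

Subtracting 1 from all parts removes the 1's, which form a horizontal strip because columns are
strict, and lowers the norm by the size of the shape (`bijOn_decr`, `finsum_ofCode_succ`). The
alternants `det (x_i ^ l_j)` at `q, …, q^n` branch in the same way (`alternant_pow_succ`), so up to
a factor independent of the shape they are these generating functions
(`alternantFactor_mul_finsum`). At most `c` columns means exponents below `c + n`.

In generic variables, the sum of the alternants with exponents below `N` and the Vandermonde product
times `littlewoodSum` obey the same recurrence in `N` (`alternantSum_succ`, `littlewoodSum_succ`),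
so they agree once they agree at `N = 0`. Row by row expansion of `orthoDet` gives Vandermonde times
kernel times `littlewoodSum` (`orthoDet_eq`). Since `orthoDet` vanishes at `N = 0` for at least one
variable, this supplies the initial value and then the identity `alternantSum_mul_littlewoodKernel`.

At powers of `q`, `orthoDet` becomes a Vandermonde determinant in the quantities `q^i +
q^(c+2n-1-i)`, whose part depending on `c` is `staircaseProd` (`orthoDet_pow`). The other factors
are never computed: they cancel on comparison with `c = 0`, where only the empty array is counted.
-/

/-! ### Products over pairs of indices. -/

/-- The product of `g i j` over the pairs `i < j` in `T`. -/
def pairProd {ι M : Type*} [LinearOrder ι] [CommMonoid M] (g : ι → ι → M) (T : Finset ι) : M :=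
  ∏ i ∈ T, ∏ j ∈ T, if i < j then g i j else 1

theorem pairProd_eq_erase {ι M : Type*} [LinearOrder ι] [CommMonoid M] (g : ι → ι → M)
    {T : Finset ι} {p : ι} (hp : p ∈ T) :
    pairProd g T = (∏ j ∈ T.erase p, if p < j then g p j else g j p) * pairProd g (T.erase p) := by
  unfold pairProd
  rw [← Finset.mul_prod_erase T _ hp, ← Finset.mul_prod_erase T _ hp]
  simp only [lt_irrefl, if_false, one_mul]
  have : ∀ i ∈ T.erase p, (∏ j ∈ T, if i < j then g i j else 1) =
      (if i < p then g i p else 1) * ∏ j ∈ T.erase p, if i < j then g i j else 1 := fun i _ =>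
    (Finset.mul_prod_erase T (fun j => if i < j then g i j else 1) hp).symm
  rw [Finset.prod_congr rfl this, Finset.prod_mul_distrib, ← mul_assoc, ← Finset.prod_mul_distrib]
  congr 1
  refine Finset.prod_congr rfl fun j hj => ?_
  rcases lt_trichotomy p j with h | h | h
  · simp [h, h.not_gt]
  · exact absurd h.symm (Finset.ne_of_mem_erase hj)
  · simp [h, h.not_gt]

theorem pairProd_congr {ι M : Type*} [LinearOrder ι] [CommMonoid M] {g h : ι → ι → M}
    {T : Finset ι} (H : ∀ i ∈ T, ∀ j ∈ T, i < j → g i j = h i j) : pairProd g T = pairProd h T := by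
  refine Finset.prod_congr rfl fun i hi => Finset.prod_congr rfl fun j hj => ?_
  split_ifs with hij
  · exact H i hi j hj hij
  · rfl

theorem pairProd_mul {ι M : Type*} [LinearOrder ι] [CommMonoid M] (g h : ι → ι → M)
    (T : Finset ι) : pairProd (fun i j => g i j * h i j) T = pairProd g T * pairProd h T := by
  simp only [pairProd, ← Finset.prod_mul_distrib]
  refine Finset.prod_congr rfl fun i _ => Finset.prod_congr rfl fun j _ => ?_
  split_ifs <;> simp

theorem pairProd_map {ι κ M : Type*} [LinearOrder ι] [LinearOrder κ] [CommMonoid M] (e : ι ↪o κ)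
    (g : κ → κ → M) (T : Finset ι) :
    pairProd g (T.map e.toEmbedding) = pairProd (fun i j => g (e i) (e j)) T := by
  simp [pairProd, Finset.prod_map]

theorem pairProd_ne_zero {ι K : Type*} [LinearOrder ι] [Field K] {g : ι → ι → K} {T : Finset ι}
    (H : ∀ i ∈ T, ∀ j ∈ T, i < j → g i j ≠ 0) : pairProd g T ≠ 0 := by
  refine Finset.prod_ne_zero_iff.2 fun i hi => Finset.prod_ne_zero_iff.2 fun j hj => ?_
  split_ifs with hij
  · exact H i hi j hj hij
  · exact one_ne_zero

/-- Each index of `T` lies in `#T - 1` pairs. -/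
theorem pairProd_mul_eq_pow {ι M : Type*} [LinearOrder ι] [CommMonoid M] (y : ι → M)
    (T : Finset ι) :
    pairProd (fun i j => y i * y j) T = (∏ i ∈ T, y i) ^ (T.card - 1) := by
  induction T using Finset.induction_on_max with
  | empty => simp [pairProd]
  | insert a s ha ih =>
    have has : a ∉ s := fun h => lt_irrefl _ (ha a h)
    rw [pairProd_eq_erase _ (Finset.mem_insert_self a s), Finset.erase_insert has, ih,
      Finset.prod_insert has, Finset.card_insert_of_notMem has, Nat.add_sub_cancel]
    have : ∀ j ∈ s, (if a < j then y a * y j else y j * y a) = y a * y j := fun j _ => by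
      split_ifs
      · rfl
      · exact mul_comm _ _
    rw [Finset.prod_congr rfl this, Finset.prod_mul_distrib, Finset.prod_const, mul_pow, mul_assoc,
      ← pow_succ']
    rcases s.eq_empty_or_nonempty with rfl | hs
    · simp
    · rw [Nat.sub_add_cancel hs.card_pos]

/-! ### Lagrange interpolation. -/

/-- A partial fraction identity, obtained by interpolating `∏ (x_j t - 1)` at the points `x_j`
and `-1`. -/
theorem sum_sub_one_mul_prod_div {ι K : Type*} [DecidableEq ι] [Field K] (x : ι → K)
    (S : Finset ι) (hinj : Set.InjOn x S) (h1 : ∀ i ∈ S, x i ≠ -1) :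
    ∑ p ∈ S, (x p - 1) * ∏ j ∈ S.erase p, (x p * x j - 1) / (x p - x j) = ∏ i ∈ S, x i - 1 := by
  let v : Option ι → K := fun o => o.elim (-1) x
  let P : Polynomial K := ∏ j ∈ S, (Polynomial.C (x j) * Polynomial.X - 1)
  have hv : Set.InjOn v (Finset.insertNone S) := by
    rintro (_ | a) ha (_ | b) hb hab
    · rfl
    · exact absurd hab.symm (h1 b (by simpa using hb))
    · exact absurd hab (h1 a (by simpa using ha))
    · exact congrArg some (hinj (by simpa using ha) (by simpa using hb) hab)
  have hdeg : ∀ j ∈ S, (Polynomial.C (x j) * Polynomial.X - 1).natDegree ≤ 1 := fun j _ => by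
    compute_degree
  have hP : P.natDegree ≤ S.card := by
    refine (Polynomial.natDegree_prod_le _ _).trans ?_
    exact (Finset.sum_le_sum hdeg).trans (by rw [Finset.sum_const, smul_eq_mul, mul_one])
  have hcoeff : P.coeff S.card = ∏ j ∈ S, x j := by
    have := Polynomial.coeff_prod_of_natDegree_le (s := S)
      (fun j => Polynomial.C (x j) * Polynomial.X - 1) 1 hdeg
    rw [mul_one] at this
    rw [this]
    refine Finset.prod_congr rfl fun j _ => ?_
    simp [Polynomial.coeff_one]
  have heval : ∀ t, P.eval t = ∏ j ∈ S, (t * x j - 1) := fun t => by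
    rw [Polynomial.eval_prod]
    refine Finset.prod_congr rfl fun j _ => ?_
    simp only [Polynomial.eval_sub, Polynomial.eval_mul, Polynomial.eval_C, Polynomial.eval_X,
      Polynomial.eval_one]
    ring
  -- The `#S + 1` nodes determine the coefficient of degree `#S`. The node `none`, standing for
  -- `-1`, contributes exactly 1; at `x p` the factor `x p ^ 2 - 1` of `P` meets the denominator `x
  -- p + 1`.
  have key := Lagrange.coeff_eq_sum hv (P := P) (by
    refine lt_of_le_of_lt Polynomial.degree_le_natDegree ?_
    rw [Finset.card_insertNone]
    exact_mod_cast Nat.lt_succ_of_le hP)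
  rw [Finset.card_insertNone, Nat.add_sub_cancel, hcoeff, Finset.sum_insertNone] at key
  have e1 : (Finset.insertNone S).erase none = S.map Function.Embedding.some := by
    ext (_ | a) <;> simp
  have e2 : ∀ p, (Finset.insertNone S).erase (some p) = Finset.insertNone (S.erase p) := by
    intro p; ext (_ | a) <;> simp
  have t1 : P.eval (v none) / ∏ j ∈ (Finset.insertNone S).erase none, (v none - v j) = 1 := by
    rw [e1, Finset.prod_map, heval]
    have : ∏ j ∈ S, (v none * x j - 1) = ∏ j ∈ S, (v none - v (some j)) := by
      refine Finset.prod_congr rfl fun j _ => ?_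
      simp only [v, Option.elim]; ring
    rw [this]
    refine div_self (Finset.prod_ne_zero_iff.2 fun j hj h => h1 j hj ?_)
    simpa [v, sub_eq_zero] using (sub_eq_zero.1 h).symm
  rw [t1] at key
  rw [key, add_sub_cancel_left]
  refine Finset.sum_congr rfl fun p hp => ?_
  rw [e2, Finset.prod_insertNone, heval, ← Finset.mul_prod_erase S _ hp, Finset.prod_div_distrib]
  have : x p + 1 ≠ 0 := fun h => h1 p hp (eq_neg_of_add_eq_zero_left h)
  simp only [v, Option.elim, sub_neg_eq_add]
  have e3 : x p * x p - 1 = (x p - 1) * (x p + 1) := by ring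
  rw [e3, mul_right_comm, mul_comm (x p + 1), mul_div_mul_right _ _ this, mul_div_assoc]

/-! ### The closed form of the bounded Littlewood sum and its recurrence. -/

/-- The reciprocal of the sum of all Schur functions in the variables `y_i`, `i ∈ T`. -/
def littlewoodKernel {ι K : Type*} [LinearOrder ι] [Field K] (y : ι → K) (T : Finset ι) : K :=
  (∏ i ∈ T, (1 - y i)) * pairProd (fun i j => 1 - y i * y j) T

theorem littlewoodKernel_eq_erase {ι K : Type*} [LinearOrder ι] [Field K] (y : ι → K)
    {T : Finset ι} {p : ι} (hp : p ∈ T) :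
    littlewoodKernel y T =
      (1 - y p) * (∏ j ∈ T.erase p, (1 - y p * y j)) * littlewoodKernel y (T.erase p) := by
  unfold littlewoodKernel
  rw [pairProd_eq_erase _ hp, ← Finset.mul_prod_erase T _ hp]
  have : ∀ j ∈ T.erase p, (if p < j then 1 - y p * y j else 1 - y j * y p) = 1 - y p * y j :=
    fun j _ => by rw [mul_comm (y j), ite_self]
  rw [Finset.prod_congr rfl this]
  ring

theorem littlewoodKernel_congr {ι K : Type*} [LinearOrder ι] [Field K] {y z : ι → K}
    {T : Finset ι} (h : ∀ i ∈ T, y i = z i) : littlewoodKernel y T = littlewoodKernel z T := by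
  unfold littlewoodKernel
  rw [Finset.prod_congr rfl fun i hi => by rw [h i hi],
    pairProd_congr fun i hi j hj _ => by rw [h i hi, h j hj]]

/-- The family `x` with the variables indexed by `S` inverted. -/
def invertOn {ι K : Type*} [DecidableEq ι] [Field K] (x : ι → K) (S : Finset ι) (i : ι) : K :=
  if i ∈ S then (x i)⁻¹ else x i

/-- The conditions under which the sums below have no vanishing denominators. -/
structure Generic {ι K : Type*} [Field K] (x : ι → K) : Prop where
  inj : Function.Injective x
  ne_zero : ∀ i, x i ≠ 0
  mul_ne_one : ∀ i j, x i * x j ≠ 1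

theorem Generic.ne_one {ι K : Type*} [Field K] {x : ι → K} (hx : Generic x) (i : ι) : x i ≠ 1 :=
  fun h => hx.mul_ne_one i i (by rw [h, one_mul])

theorem Generic.ne_neg_one {ι K : Type*} [Field K] {x : ι → K} (hx : Generic x) (i : ι) :
    x i ≠ -1 :=
  fun h => hx.mul_ne_one i i (by rw [h]; ring)

theorem Generic.comp {ι κ K : Type*} [Field K] {x : ι → K} (hx : Generic x) {e : κ → ι}
    (he : Function.Injective e) : Generic (x ∘ e) :=
  ⟨hx.inj.comp he, fun _ => hx.ne_zero _, fun _ _ => hx.mul_ne_one _ _⟩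

theorem Generic.one_sub_invertOn_ne_zero {ι K : Type*} [DecidableEq ι] [Field K] {x : ι → K}
    (hx : Generic x) (S : Finset ι) (i : ι) : 1 - invertOn x S i ≠ 0 := by
  rw [sub_ne_zero, invertOn]
  have := hx.ne_one i
  split_ifs
  · exact fun h => this (inv_eq_one.1 h.symm)
  · exact this.symm

theorem Generic.one_sub_invertOn_mul_ne_zero {ι K : Type*} [DecidableEq ι] [Field K] {x : ι → K}
    (hx : Generic x) (S : Finset ι) {i j : ι} (hij : i ≠ j) :
    1 - invertOn x S i * invertOn x S j ≠ 0 := by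
  rw [sub_ne_zero, invertOn, invertOn]
  have hi := hx.ne_zero i
  have hj := hx.ne_zero j
  have h1 := hx.mul_ne_one i j
  have h2 := hx.inj.ne hij
  split_ifs
  · rw [← mul_inv]
    exact fun h => h1 (inv_eq_one.1 h.symm)
  · intro h
    field_simp at h
    exact h2 h
  · intro h
    field_simp at h
    exact h2 h.symm
  · exact h1.symm

theorem Generic.littlewoodKernel_ne_zero {ι K : Type*} [LinearOrder ι] [Field K] {x : ι → K}
    (hx : Generic x) (S T : Finset ι) : littlewoodKernel (invertOn x S) T ≠ 0 :=
  mul_ne_zero (Finset.prod_ne_zero_iff.2 fun i _ => hx.one_sub_invertOn_ne_zero S i)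
    (pairProd_ne_zero fun _ _ _ _ hij => hx.one_sub_invertOn_mul_ne_zero S hij.ne)

/-- The coefficient of `(∏ i ∈ S, x i) ^ N` in the bounded Littlewood sum. -/
def littlewoodCoeff {ι K : Type*} [LinearOrder ι] [Field K] (x : ι → K) (S T : Finset ι) : K :=
  ((∏ i ∈ S, x i) ^ T.card * littlewoodKernel (invertOn x S) T)⁻¹

/-- The closed form of the sum of the Schur functions in the variables `x i`, `i ∈ T`, of the
shapes with at most `N - #T` columns. -/
def littlewoodSum {ι K : Type*} [LinearOrder ι] [Field K] (x : ι → K) (T : Finset ι) (N : ℕ) : K :=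
  ∑ S ∈ T.powerset, littlewoodCoeff x S T * (∏ i ∈ S, x i) ^ N

/-- In the kernel of the variables inverted on `S`, an index `j ∉ S` gives `1 - x j / x p`, which up
to a power of `x p` cancels `x p - x j`. Only the `j ∈ S` leave a quotient, of the shape needed for
the partial fraction identity. -/
theorem littlewoodCoeff_erase {ι K : Type*} [LinearOrder ι] [Field K] {x : ι → K}
    (hx : Generic x) {S T : Finset ι} (hST : S ⊆ T) {p : ι} (hp : p ∈ S) :
    (∏ j ∈ T.erase p, (x p - x j))⁻¹ * littlewoodCoeff x (S.erase p) (T.erase p) =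
      littlewoodCoeff x S T *
        ((x p - 1) * ∏ j ∈ S.erase p, (x p * x j - 1) / (x p - x j)) := by
  have hpT := hST hp
  have hflip : littlewoodKernel (invertOn x (S.erase p)) (T.erase p) =
      littlewoodKernel (invertOn x S) (T.erase p) := by
    refine littlewoodKernel_congr fun i hi => ?_
    simp [invertOn, Finset.ne_of_mem_erase hi]
  have hp0 := hx.ne_zero p
  -- All products are spread over `T.erase p`, so that `hC` can be checked factor by factor.
  have hA : x p ^ (T.erase p).card * ∏ j ∈ S.erase p, x j =
      ∏ j ∈ T.erase p, x p * (if j ∈ S then x j else 1) := by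
    rw [Finset.prod_mul_distrib, Finset.prod_const, ← Finset.prod_filter]
    congr 2
    ext j
    simp only [Finset.mem_erase, Finset.mem_filter]
    exact ⟨fun h => ⟨⟨h.1, hST h.2⟩, h.2⟩, fun h => ⟨h.1.1, h.2⟩⟩
  have hB : ∏ j ∈ S.erase p, (x p * x j - 1) / (x p - x j) =
      ∏ j ∈ T.erase p, if j ∈ S then (x p * x j - 1) / (x p - x j) else 1 := by
    rw [← Finset.prod_filter]
    congr 1
    ext j
    simp only [Finset.mem_erase, Finset.mem_filter]
    exact ⟨fun h => ⟨⟨h.1, hST h.2⟩, h.2⟩, fun h => ⟨h.1.1, h.2⟩⟩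
  have hC : (x p ^ (T.erase p).card * ∏ j ∈ S.erase p, x j) *
      ∏ j ∈ T.erase p, (1 - invertOn x S p * invertOn x S j) =
      (∏ j ∈ S.erase p, (x p * x j - 1) / (x p - x j)) * ∏ j ∈ T.erase p, (x p - x j) := by
    rw [hA, hB, ← Finset.prod_mul_distrib, ← Finset.prod_mul_distrib]
    refine Finset.prod_congr rfl fun j hj => ?_
    have hj0 := hx.ne_zero j
    have hpj : x p - x j ≠ 0 := sub_ne_zero.2 (hx.inj.ne (Finset.ne_of_mem_erase hj).symm)
    simp only [invertOn, hp, if_true]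
    split_ifs
    · field_simp
    · field_simp
  have hcard : T.card = (T.erase p).card + 1 := (Finset.card_erase_add_one hpT).symm
  have hW := hx.littlewoodKernel_ne_zero S (T.erase p)
  have hV : ∏ j ∈ T.erase p, (x p - x j) ≠ 0 := Finset.prod_ne_zero_iff.2 fun j hj =>
    sub_ne_zero.2 (hx.inj.ne (Finset.ne_of_mem_erase hj).symm)
  have hX : ∏ j ∈ S.erase p, x j ≠ 0 := Finset.prod_ne_zero_iff.2 fun j _ => hx.ne_zero j
  have hF : ∏ j ∈ T.erase p, (1 - invertOn x S p * invertOn x S j) ≠ 0 :=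
    Finset.prod_ne_zero_iff.2 fun j hj =>
      hx.one_sub_invertOn_mul_ne_zero S (Finset.ne_of_mem_erase hj).symm
  have h1 := hx.one_sub_invertOn_ne_zero S p
  have h1' : x p - 1 = x p * (1 - invertOn x S p) := by
    simp only [invertOn, hp, if_true]
    field_simp
  unfold littlewoodCoeff
  rw [hflip, littlewoodKernel_eq_erase _ hpT, hcard, ← Finset.mul_prod_erase S _ hp, h1']
  generalize (T.erase p).card = m at *
  generalize ∏ j ∈ S.erase p, (x p * x j - 1) / (x p - x j) = Q at *
  generalize ∏ j ∈ T.erase p, (x p - x j) = V at *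
  generalize ∏ j ∈ S.erase p, x j = X at *
  generalize ∏ j ∈ T.erase p, (1 - invertOn x S p * invertOn x S j) = F at *
  generalize littlewoodKernel (invertOn x S) (T.erase p) = W at *
  generalize 1 - invertOn x S p = w at *
  generalize x p = a at *
  rw [← mul_inv]
  have : Q = a ^ m * X * F / V := by rw [hC]; field_simp
  rw [this]
  field_simp
  ring

theorem sum_littlewoodCoeff_erase {ι K : Type*} [LinearOrder ι] [Field K] {x : ι → K}
    (hx : Generic x) {S T : Finset ι} (hST : S ⊆ T) :
    ∑ p ∈ S, (∏ j ∈ T.erase p, (x p - x j))⁻¹ * littlewoodCoeff x (S.erase p) (T.erase p) =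
      littlewoodCoeff x S T * (∏ i ∈ S, x i - 1) := by
  rw [Finset.sum_congr rfl fun p hp => littlewoodCoeff_erase hx hST hp, ← Finset.mul_sum,
    sum_sub_one_mul_prod_div x S hx.inj.injOn fun i _ => hx.ne_neg_one i]

/-- After reindexing by `(p, S) ↦ insert p S`, the coefficients of `(∏ i ∈ S, x i) ^ N` are compared
for each `S` separately. -/
theorem littlewoodSum_succ {ι K : Type*} [LinearOrder ι] [Field K] {x : ι → K}
    (hx : Generic x) (T : Finset ι) (N : ℕ) :
    littlewoodSum x T (N + 1) = littlewoodSum x T N +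
      ∑ p ∈ T, x p ^ N * (∏ j ∈ T.erase p, (x p - x j))⁻¹ * littlewoodSum x (T.erase p) N := by
  have h1 : ∑ p ∈ T, x p ^ N * (∏ j ∈ T.erase p, (x p - x j))⁻¹ * littlewoodSum x (T.erase p) N =
      ∑ S ∈ T.powerset, ∑ p ∈ S, (∏ i ∈ S, x i) ^ N *
        ((∏ j ∈ T.erase p, (x p - x j))⁻¹ * littlewoodCoeff x (S.erase p) (T.erase p)) := by
    simp only [littlewoodSum, Finset.mul_sum]
    rw [Finset.sum_sigma', Finset.sum_sigma']
    refine Finset.sum_bij' (fun a _ => ⟨insert a.1 a.2, a.1⟩) (fun a _ => ⟨a.2, a.1.erase a.2⟩)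
      ?_ ?_ ?_ ?_ ?_
    · rintro ⟨p, S⟩ h
      simp only [Finset.mem_sigma, Finset.mem_powerset] at h ⊢
      exact ⟨Finset.insert_subset h.1 (h.2.trans (Finset.erase_subset _ _)),
        Finset.mem_insert_self _ _⟩
    · rintro ⟨S, p⟩ h
      simp only [Finset.mem_sigma, Finset.mem_powerset] at h ⊢
      exact ⟨h.1 h.2, Finset.erase_subset_erase _ h.1⟩
    · rintro ⟨p, S⟩ h
      simp only [Finset.mem_sigma, Finset.mem_powerset] at h ⊢
      rw [Finset.erase_insert fun hp => Finset.notMem_erase _ _ (h.2 hp)]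
    · rintro ⟨S, p⟩ h
      simp only [Finset.mem_sigma, Finset.mem_powerset] at h ⊢
      rw [Finset.insert_erase h.2]
    · rintro ⟨p, S⟩ h
      simp only [Finset.mem_sigma, Finset.mem_powerset] at h ⊢
      have hp : p ∉ S := fun hp => Finset.notMem_erase _ _ (h.2 hp)
      rw [Finset.erase_insert hp, Finset.prod_insert hp, mul_pow]
      ring
  rw [h1]
  simp only [← Finset.mul_sum]
  rw [littlewoodSum, littlewoodSum, ← Finset.sum_add_distrib]
  refine Finset.sum_congr rfl fun S hS => ?_
  rw [sum_littlewoodCoeff_erase hx (Finset.mem_powerset.1 hS)]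
  ring

/-- Transports the sum over `univ.erase p` in `Fin (n + 1)` to `Fin n`, where alternants live. -/
theorem littlewoodSum_map {ι κ K : Type*} [LinearOrder ι] [LinearOrder κ] [Field K] (e : ι ↪o κ)
    (x : κ → K) (T : Finset ι) (N : ℕ) :
    littlewoodSum x (T.map e.toEmbedding) N = littlewoodSum (x ∘ e) T N := by
  unfold littlewoodSum
  have hp : (T.map e.toEmbedding).powerset =
      T.powerset.map (Finset.mapEmbedding e.toEmbedding).toEmbedding := by
    ext S
    simp only [Finset.mem_powerset, Finset.mem_map, Finset.subset_map_iff]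
    exact ⟨fun ⟨u, h1, h2⟩ => ⟨u, h1, h2.symm⟩, fun ⟨u, h1, h2⟩ => ⟨u, h1, h2.symm⟩⟩
  rw [hp, Finset.sum_map]
  refine Finset.sum_congr rfl fun S _ => ?_
  simp only [RelEmbedding.coe_toEmbedding, Finset.mapEmbedding_apply, Finset.prod_map,
    littlewoodCoeff, littlewoodKernel, pairProd_map, Finset.card_map, invertOn,
    Finset.mem_map, Function.comp]
  simp

/-! ### Sums of alternants. -/

open Classical in
/-- The strictly increasing sequences of length `n` with values below `N`. -/
noncomputable def strictSeqs (n N : ℕ) : Finset (Fin n → ℕ) :=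
  (Fintype.piFinset fun _ => Finset.range N).filter StrictMono

theorem mem_strictSeqs {n N : ℕ} {l : Fin n → ℕ} :
    l ∈ strictSeqs n N ↔ (∀ i, l i < N) ∧ StrictMono l := by
  simp [strictSeqs]

theorem sum_strictSeqs_succ {M : Type*} [AddCommMonoid M] (n N : ℕ) (f : (Fin (n + 1) → ℕ) → M) :
    ∑ l ∈ strictSeqs (n + 1) (N + 1), f l =
      ∑ l ∈ strictSeqs (n + 1) N, f l + ∑ l ∈ strictSeqs n N, f (Fin.snoc l N) := by
  rw [← Finset.sum_filter_add_sum_filter_not (strictSeqs (n + 1) (N + 1))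
    (fun l => l (Fin.last n) < N)]
  congr 1
  · refine Finset.sum_congr ?_ fun _ _ => rfl
    ext l
    simp only [Finset.mem_filter, mem_strictSeqs]
    constructor
    · rintro ⟨⟨_, h⟩, h'⟩
      exact ⟨fun i => (h.monotone (Fin.le_last i)).trans_lt h', h⟩
    · rintro ⟨h, h'⟩
      exact ⟨⟨fun i => (h i).trans (Nat.lt_succ_self N), h'⟩, h _⟩
  · refine (Finset.sum_bij' (fun l _ => Fin.snoc l N) (fun l _ => Fin.init l) ?_ ?_ ?_ ?_ ?_).symm
    · intro l hl
      rw [mem_strictSeqs] at hl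
      rw [Finset.mem_filter, mem_strictSeqs]
      refine ⟨⟨fun i => ?_, Fin.strictMono_iff_lt_succ.2 fun i => ?_⟩, by simp⟩
      · refine Fin.lastCases ?_ (fun i => ?_) i
        · simp
        · simpa using (hl.1 i).trans (Nat.lt_succ_self N)
      · rcases n with _ | n
        · exact i.elim0
        · refine Fin.lastCases ?_ (fun i => ?_) i
          · rw [Fin.succ_last, Fin.snoc_last, Fin.snoc_castSucc]
            exact hl.1 _
          · rw [Fin.succ_castSucc, Fin.snoc_castSucc, Fin.snoc_castSucc]
            exact hl.2 (Fin.castSucc_lt_succ)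
    · intro l hl
      rw [Finset.mem_filter, mem_strictSeqs] at hl
      rw [mem_strictSeqs]
      obtain ⟨⟨h1, h2⟩, h3⟩ := hl
      refine ⟨fun i => ?_, fun i j hij => h2 (Fin.castSucc_lt_castSucc_iff.2 hij)⟩
      exact lt_of_lt_of_le (h2 (Fin.castSucc_lt_last i)) (Nat.lt_succ_iff.1 (h1 _))
    · intro l _
      exact Fin.init_snoc _ _
    · intro l hl
      rw [Finset.mem_filter, mem_strictSeqs] at hl
      have : l (Fin.last n) = N := le_antisymm (Nat.lt_succ_iff.1 (hl.1.1 _)) (not_lt.1 hl.2)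
      rw [← this]
      exact Fin.snoc_init_self l
    · intro l _
      rfl

/-- The alternant `det (x_i ^ l_j)`. -/
def alternant {n : ℕ} {R : Type*} [CommRing R] (x : Fin n → R) (l : Fin n → ℕ) : R :=
  (Matrix.of fun i j => x i ^ l j).det

theorem alternant_snoc {n : ℕ} {R : Type*} [CommRing R] (x : Fin (n + 1) → R) (l : Fin n → ℕ)
    (N : ℕ) : alternant x (Fin.snoc l N) =
      ∑ i : Fin (n + 1), (-1) ^ (i + n : ℕ) * x i ^ N * alternant (x ∘ i.succAbove) l := by
  rw [alternant, Matrix.det_succ_column _ (Fin.last n)]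
  refine Finset.sum_congr rfl fun i _ => ?_
  simp only [Matrix.of_apply, Fin.snoc_last, Fin.val_last, alternant]
  congr 2
  ext a b
  simp [Fin.succAbove_last]

/-- The sum of all alternants with exponents below `N`. -/
noncomputable def alternantSum {n : ℕ} {R : Type*} [CommRing R] (x : Fin n → R) (N : ℕ) : R :=
  ∑ l ∈ strictSeqs n N, alternant x l

/-- The new alternants have largest exponent `N`; they are expanded along their last column. -/
theorem alternantSum_succ {n : ℕ} {R : Type*} [CommRing R] (x : Fin (n + 1) → R) (N : ℕ) :
    alternantSum x (N + 1) = alternantSum x N +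
      ∑ i : Fin (n + 1), (-1) ^ (i + n : ℕ) * x i ^ N * alternantSum (x ∘ i.succAbove) N := by
  simp only [alternantSum, sum_strictSeqs_succ, alternant_snoc, Finset.mul_sum]
  congr 1
  exact Finset.sum_comm

/-! ### Vandermonde products and the comparison of the two recurrences. -/

/-- The Vandermonde product. -/
def vdmProd {n : ℕ} {R : Type*} [CommRing R] (x : Fin n → R) : R :=
  pairProd (fun i j => x j - x i) Finset.univ

theorem vdmProd_eq_det {n : ℕ} {R : Type*} [CommRing R] (x : Fin n → R) :
    vdmProd x = (Matrix.vandermonde x).det := by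
  rw [Matrix.det_vandermonde, vdmProd, pairProd]
  refine Finset.prod_congr rfl fun i _ => ?_
  rw [← Finset.prod_filter]
  congr 1
  ext j
  simp

theorem vdmProd_ne_zero {n : ℕ} {K : Type*} [Field K] {x : Fin n → K}
    (hx : Function.Injective x) : vdmProd x ≠ 0 :=
  pairProd_ne_zero fun _ _ _ _ h => sub_ne_zero.2 (hx.ne h.ne')

theorem univ_erase_eq_map {n : ℕ} (p : Fin (n + 1)) :
    Finset.univ.erase p = Finset.univ.map (Fin.succAboveOrderEmb p).toEmbedding := by
  ext j
  rw [Finset.mem_map]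
  exact ⟨fun h => (Fin.exists_succAbove_eq (Finset.ne_of_mem_erase h)).imp
    fun a ha => ⟨Finset.mem_univ a, ha⟩, fun ⟨a, _, ha⟩ => Finset.mem_erase.2
      ⟨fun h => Fin.succAbove_ne p a (ha.trans h), Finset.mem_univ j⟩⟩

theorem vdmProd_eq_succAbove {n : ℕ} {R : Type*} [CommRing R] (x : Fin (n + 1) → R)
    (p : Fin (n + 1)) : vdmProd x = (-1) ^ (p + n : ℕ) *
      (∏ j ∈ Finset.univ.erase p, (x p - x j)) * vdmProd (x ∘ p.succAbove) := by
  rw [vdmProd, pairProd_eq_erase _ (Finset.mem_univ p)]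
  congr 1
  · have : ∀ j ∈ Finset.univ.erase p, (if p < j then x j - x p else x p - x j) =
        (if p < j then -1 else 1) * (x p - x j) := fun j _ => by split_ifs <;> ring
    rw [Finset.prod_congr rfl this, Finset.prod_mul_distrib]
    congr 1
    rw [Finset.prod_ite, Finset.prod_const, Finset.prod_const_one, mul_one]
    have : (Finset.univ.erase p).filter (p < ·) = Finset.Ioi p := by
      ext j
      simp only [Finset.mem_filter, Finset.mem_erase, Finset.mem_univ, Finset.mem_Ioi]
      exact ⟨fun h => h.2, fun h => ⟨⟨h.ne', trivial⟩, h⟩⟩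
    rw [this, Fin.card_Ioi]
    have hp := Fin.is_le p
    -- The sign counts the `n - p` indices above `p`, a number of the same parity as `p + n`.
    have : (p + n : ℕ) = (n + 1 - 1 - p) + 2 * p := by omega
    rw [this, pow_add, pow_mul]
    simp
  · rw [univ_erase_eq_map, pairProd_map]
    rfl

theorem alternantSum_eq_of_vanish {K : Type*} [Field K]
    (H : ∀ (n : ℕ) (x : Fin (n + 1) → K), Generic x → littlewoodSum x Finset.univ 0 = 0)
    (N : ℕ) : ∀ {n : ℕ} {x : Fin n → K}, Generic x →
      alternantSum x N = vdmProd x * littlewoodSum x Finset.univ N := by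
  have h0 : ∀ (N : ℕ) (x : Fin 0 → K),
      alternantSum x N = vdmProd x * littlewoodSum x Finset.univ N := fun N x => by
    have : strictSeqs 0 N = {Fin.elim0} := by
      ext l
      simp only [mem_strictSeqs, Finset.mem_singleton]
      exact ⟨fun _ => Subsingleton.elim _ _, fun _ => ⟨fun i => i.elim0, fun i => i.elim0⟩⟩
    simp [alternantSum, this, alternant, vdmProd, pairProd, littlewoodSum, littlewoodCoeff,
      littlewoodKernel]
  induction N with
  | zero =>
    rintro (_ | n) x hx
    · exact h0 _ _
    · rw [H n x hx, mul_zero, alternantSum]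
      refine Finset.sum_eq_zero fun l hl => ?_
      exact absurd ((mem_strictSeqs.1 hl).1 0) (Nat.not_lt_zero _)
  | succ N ih =>
    rintro (_ | n) x hx
    · exact h0 _ _
    · rw [alternantSum_succ, littlewoodSum_succ hx, mul_add, ih hx, Finset.mul_sum]
      congr 1
      refine Finset.sum_congr rfl fun p _ => ?_
      rw [ih (hx.comp Fin.succAbove_right_injective), univ_erase_eq_map, littlewoodSum_map,
        ← univ_erase_eq_map, vdmProd_eq_succAbove x p]
      have hV : ∏ j ∈ Finset.univ.erase p, (x p - x j) ≠ 0 :=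
        Finset.prod_ne_zero_iff.2 fun j hj =>
          sub_ne_zero.2 (hx.inj.ne (Finset.ne_of_mem_erase hj).symm)
      simp only [Fin.succAboveOrderEmb_apply, Function.comp_def]
      field_simp

/-! ### The odd orthogonal determinant and the bounded Littlewood identity. -/

/-- The numerator determinant of an odd orthogonal character of rectangular shape. -/
def orthoDet {n : ℕ} {R : Type*} [CommRing R] (x : Fin n → R) (N : ℕ) : R :=
  (Matrix.of fun j i : Fin n => x j ^ (i : ℕ) - x j ^ (N + n - 1 - i)).det

/-- Since `(y_j - y_i)(1 - y_i y_j) = y_i y_j ((y_i + 1/y_i) - (y_j + 1/y_j))` and `y + 1/y` is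
unchanged by inversion, inverting variables alters the Vandermonde product times the pair kernel
only by a monomial. -/
theorem vdmProd_invertOn {n : ℕ} {K : Type*} [Field K] {x : Fin n → K} (hx : Generic x)
    (S : Finset (Fin n)) (N : ℕ) :
    (∏ i ∈ S, -x i ^ (N + n - 1)) * vdmProd (invertOn x S) =
      vdmProd x * littlewoodKernel x Finset.univ *
        (littlewoodCoeff x S Finset.univ * (∏ i ∈ S, x i) ^ N) := by
  rcases n with _ | n
  · have : S = ∅ := Subsingleton.elim _ _
    simp [this, vdmProd, pairProd, littlewoodCoeff, littlewoodKernel]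
  have hpair : ∀ y : Fin (n + 1) → K, (∀ i, y i ≠ 0) →
      vdmProd y * pairProd (fun i j => 1 - y i * y j) Finset.univ =
        (∏ i, y i) ^ n *
          pairProd (fun i j => (y i + (y i)⁻¹) - (y j + (y j)⁻¹)) Finset.univ := by
    intro y hy
    have h := pairProd_mul_eq_pow y Finset.univ
    rw [Finset.card_univ, Fintype.card_fin, Nat.add_sub_cancel] at h
    rw [vdmProd, ← h, ← pairProd_mul, ← pairProd_mul]
    refine pairProd_congr fun i _ j _ _ => ?_
    have := hy i
    have := hy j
    field_simp
    ring
  have hy0 : ∀ i, invertOn x S i ≠ 0 := fun i => by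
    have := hx.ne_zero i
    unfold invertOn
    split_ifs <;> simpa
  have hu : ∀ i, invertOn x S i + (invertOn x S i)⁻¹ = x i + (x i)⁻¹ := fun i => by
    unfold invertOn
    split_ifs
    · rw [inv_inv, add_comm]
    · rfl
  have h1 := hpair x hx.ne_zero
  have h2 := hpair _ hy0
  simp only [hu] at h2
  have hS : ∀ f : Fin (n + 1) → K, ∏ i ∈ S, f i = ∏ i, if i ∈ S then f i else 1 := fun f => by
    rw [Finset.prod_ite_mem, Finset.univ_inter]
  have hprod : (∏ i, invertOn x S i) * (∏ i ∈ S, x i) ^ 2 = ∏ i, x i := by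
    rw [← Finset.prod_pow, hS, ← Finset.prod_mul_distrib]
    refine Finset.prod_congr rfl fun i _ => ?_
    have := hx.ne_zero i
    unfold invertOn
    split_ifs <;> field_simp
  have hlin : (∏ i, (1 - invertOn x S i)) * ∏ i ∈ S, -x i = ∏ i, (1 - x i) := by
    rw [hS, ← Finset.prod_mul_distrib]
    refine Finset.prod_congr rfl fun i _ => ?_
    have := hx.ne_zero i
    unfold invertOn
    split_ifs
    · field_simp
      ring
    · ring
  have hpow : (∏ i ∈ S, -x i ^ (N + (n + 1) - 1)) * (∏ i ∈ S, x i) =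
      (∏ i ∈ S, x i) ^ N * (∏ i ∈ S, x i) ^ n * ∏ i ∈ S, -x i := by
    simp only [← Finset.prod_pow, ← Finset.prod_mul_distrib]
    refine Finset.prod_congr rfl fun i _ => ?_
    rw [← add_assoc, Nat.add_sub_cancel]
    ring
  have hX : ∏ i ∈ S, x i ≠ 0 := Finset.prod_ne_zero_iff.2 fun i _ => hx.ne_zero i
  have hY : ∏ i, invertOn x S i ≠ 0 := Finset.prod_ne_zero_iff.2 fun i _ => hy0 i
  have hW := hx.littlewoodKernel_ne_zero S Finset.univ
  unfold littlewoodCoeff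
  rw [Finset.card_univ, Fintype.card_fin]
  rw [← mul_assoc, ← div_eq_mul_inv, div_mul_eq_mul_div, eq_div_iff
    (mul_ne_zero (pow_ne_zero _ hX) hW)]
  unfold littlewoodKernel
  rw [← hprod] at h1
  rw [← hlin]
  generalize ∏ i ∈ S, x i = a at *
  generalize ∏ i, invertOn x S i = Y at *
  generalize ∏ i ∈ S, -x i ^ (N + (n + 1) - 1) = b at *
  generalize ∏ i ∈ S, -x i = c at *
  generalize ∏ i, (1 - invertOn x S i) = d at *
  generalize pairProd (fun i j => 1 - invertOn x S i * invertOn x S j) Finset.univ = P at *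
  generalize pairProd (fun i j => 1 - x i * x j) Finset.univ = Q at *
  generalize pairProd (fun i j => x i + (x i)⁻¹ - (x j + (x j)⁻¹)) Finset.univ = U at *
  have e : b * vdmProd (invertOn x S) * (a ^ (n + 1) * (d * P)) =
      (b * a) * a ^ n * d * (vdmProd (invertOn x S) * P) := by ring
  have e' : vdmProd x * (d * c * Q) * a ^ N = (vdmProd x * Q) * (d * c) * a ^ N := by ring
  rw [e, e', hpow, h1, h2]
  ring

/-- Row `j` is the sum of a Vandermonde row in `x j` and a multiple of one in `(x j)⁻¹`;
multilinearity gives one Vandermonde determinant for each set `S` of inverted variables. -/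
theorem orthoDet_eq {n : ℕ} {K : Type*} [Field K] {x : Fin n → K} (hx : Generic x) (N : ℕ) :
    orthoDet x N =
      vdmProd x * littlewoodKernel x Finset.univ * littlewoodSum x Finset.univ N := by
  have h := (Matrix.detRowAlternating (n := Fin n) (R := K)).map_add_univ
    (fun j (i : Fin n) => -x j ^ (N + n - 1) * (x j)⁻¹ ^ (i : ℕ))
    (fun j (i : Fin n) => x j ^ (i : ℕ))
  have e : orthoDet x N = Matrix.detRowAlternating
      ((fun j (i : Fin n) => -x j ^ (N + n - 1) * (x j)⁻¹ ^ (i : ℕ)) +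
        (fun j (i : Fin n) => x j ^ (i : ℕ))) := by
    unfold orthoDet
    congr 1
    ext j i
    have := hx.ne_zero j
    simp only [Matrix.of_apply, Pi.add_apply]
    have hi := i.isLt
    have : x j ^ (N + n - 1) = x j ^ (N + n - 1 - i) * x j ^ (i : ℕ) := by
      rw [← pow_add]
      congr 1
      omega
    rw [this, inv_pow]
    field_simp
    ring
  rw [e, h, littlewoodSum, Finset.mul_sum, Finset.powerset_univ]
  refine Finset.sum_congr rfl fun S _ => ?_
  rw [← vdmProd_invertOn hx, vdmProd_eq_det]
  have := Matrix.det_mul_column (fun j => if j ∈ S then -x j ^ (N + n - 1) else 1)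
    (Matrix.vandermonde (invertOn x S))
  rw [Finset.prod_ite_mem, Finset.univ_inter] at this
  rw [← this]
  change Matrix.det _ = _
  congr 1
  ext j i
  by_cases hj : j ∈ S <;> simp [hj, invertOn]

theorem orthoDet_zero {n : ℕ} {K : Type*} [Field K] (x : Fin (n + 1) → K) :
    orthoDet x 0 = 0 := by
  -- For a single variable the kernel vector used below would be twice a basis vector, which is zero
  -- in characteristic 2. Otherwise the first and last columns are opposite.
  rcases n with _ | n
  · simp [orthoDet]
  rw [orthoDet, ← Matrix.exists_mulVec_eq_zero_iff]
  refine ⟨Pi.single 0 1 + Pi.single (Fin.last _) 1, fun h => ?_, ?_⟩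
  · have := congrFun h 0
    simp [Fin.ext_iff] at this
  · ext j
    simp [Matrix.mulVec_add]

theorem littlewoodSum_zero {K : Type*} [Field K] (n : ℕ) (x : Fin (n + 1) → K) (hx : Generic x) :
    littlewoodSum x Finset.univ 0 = 0 := by
  have h := orthoDet_eq hx 0
  rw [orthoDet_zero] at h
  have h1 := vdmProd_ne_zero hx.inj
  have h2 : littlewoodKernel x Finset.univ ≠ 0 := by
    have h3 : invertOn x ∅ = x := funext fun i => by simp [invertOn]
    exact h3 ▸ hx.littlewoodKernel_ne_zero ∅ Finset.univ
  exact (mul_eq_zero.1 h.symm).resolve_left (mul_ne_zero h1 h2)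

/-- The bounded Littlewood identity in bialternant form. -/
theorem alternantSum_mul_littlewoodKernel {n : ℕ} {K : Type*} [Field K] {x : Fin n → K}
    (hx : Generic x) (N : ℕ) :
    alternantSum x N * littlewoodKernel x Finset.univ = orthoDet x N := by
  rw [alternantSum_eq_of_vanish littlewoodSum_zero N hx, orthoDet_eq hx, mul_right_comm]

/-! ### Branching of alternants. -/

theorem det_sum_pow_eq_sum_alternant {n : ℕ} {R : Type*} [CommRing R] (x : Fin n → R)
    (A : Fin n → Finset ℕ) :
    (Matrix.of fun i j : Fin n => ∑ m ∈ A j, x i ^ m).det =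
      ∑ m ∈ Fintype.piFinset A, alternant x m := by
  rw [← Matrix.det_transpose]
  have h := (Matrix.detRowAlternating (n := Fin n) (R := R)).toMultilinearMap.map_sum_finset
    (fun (_ : Fin n) (m : ℕ) (i : Fin n) => x i ^ m) A
  have e : (Matrix.of fun i j : Fin n => ∑ m ∈ A j, x i ^ m).transpose =
      fun j => ∑ m ∈ A j, fun i => x i ^ m := by
    ext j i
    simp [Finset.sum_apply]
  rw [e]
  refine h.trans (Finset.sum_congr rfl fun m _ => ?_)
  rw [alternant, ← Matrix.det_transpose]
  rfl

/-- Subtracting from each column its predecessor turns the row of the variable 1 into `(1, 0, …,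
0)`; the remaining differences are `x i - 1` times geometric sums. The intervals encode interlacing
of shapes. -/
theorem alternant_cons_one {n : ℕ} {R : Type*} [CommRing R] (x : Fin n → R)
    {l : Fin (n + 1) → ℕ} (hl : Monotone l) :
    alternant (Fin.cons 1 x : Fin (n + 1) → R) l = (∏ i, (x i - 1)) *
      ∑ m ∈ Fintype.piFinset fun j : Fin n => Finset.Ico (l j.castSucc) (l j.succ),
        alternant x m := by
  have h := Matrix.det_eq_of_forall_col_eq_smul_add_pred
    (A := Matrix.of fun i j : Fin (n + 1) => (Fin.cons 1 x : Fin (n + 1) → R) i ^ l j)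
    (B := Matrix.of fun i j : Fin (n + 1) => (Fin.cons ((Fin.cons 1 x : Fin (n + 1) → R) i ^ l 0)
      (fun j : Fin n => (Fin.cons 1 x : Fin (n + 1) → R) i ^ l j.succ -
        (Fin.cons 1 x : Fin (n + 1) → R) i ^ l j.castSucc) : Fin (n + 1) → R) j)
    (fun _ => 1) (fun i => by simp) (fun i j => by simp)
  rw [alternant, h, Matrix.det_succ_row_zero, Fin.sum_univ_succ]
  simp only [Matrix.of_apply, Fin.cons_zero, Fin.cons_succ, one_pow, sub_self, mul_zero, zero_mul,
    Finset.sum_const_zero, add_zero, Fin.val_zero, pow_zero, one_mul]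
  rw [← det_sum_pow_eq_sum_alternant, ← Matrix.det_mul_column]
  congr 1
  ext i j
  simp only [Matrix.submatrix_apply, Matrix.of_apply, Fin.cons_succ, Fin.zero_succAbove]
  rw [mul_comm, geom_sum_Ico_mul _ (hl (Fin.castSucc_le_succ j))]

theorem alternant_pow_succ {R : Type*} [CommRing R] (q : R) {n : ℕ}
    {l : Fin (n + 1) → ℕ} (hl : Monotone l) :
    alternant (fun i : Fin (n + 1) => q ^ (i + 1 : ℕ)) l =
      q ^ (∑ j, l j) * (∏ i : Fin n, (q ^ (i + 1 : ℕ) - 1)) *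
        ∑ m ∈ Fintype.piFinset fun j : Fin n => Finset.Ico (l j.castSucc) (l j.succ),
          alternant (fun i : Fin n => q ^ (i + 1 : ℕ)) m := by
  -- By homogeneity a factor `q` leaves each variable, and `q, …, q^(n+1)` becomes `1, q, …, q^n`.
  rw [mul_assoc, ← alternant_cons_one _ hl, ← Finset.prod_pow_eq_pow_sum, alternant, alternant,
    ← Matrix.det_mul_row]
  congr 1
  ext i j
  simp only [Matrix.of_apply]
  refine Fin.cases ?_ (fun i => ?_) i
  · simp
  · simp only [Fin.cons_succ, Fin.val_succ]
    ring

/-! ### Evaluation of the orthogonal determinant at powers of `q`. -/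

/-- The polynomials expressing `(b ^ (j + 1) - a ^ (j + 1)) / (b - a)` through `a + b`, for
`a * b = k`. -/
noncomputable def lucasPoly {R : Type*} [CommRing R] (k : R) : ℕ → Polynomial R
  | 0 => 1
  | 1 => Polynomial.X
  | j + 2 => Polynomial.X * lucasPoly k (j + 1) - Polynomial.C k * lucasPoly k j

theorem lucasPoly_eval {R : Type*} [CommRing R] (a b : R) :
    ∀ j, (b - a) * (lucasPoly (a * b) j).eval (a + b) = b ^ (j + 1) - a ^ (j + 1)
  | 0 => by simp [lucasPoly]
  | 1 => by simp [lucasPoly]; ring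
  | j + 2 => by
    have h1 := lucasPoly_eval a b (j + 1)
    have h0 := lucasPoly_eval a b j
    simp only [lucasPoly, Polynomial.eval_sub, Polynomial.eval_mul, Polynomial.eval_X,
      Polynomial.eval_C]
    linear_combination (a + b) * h1 - a * b * h0

theorem lucasPoly_monic {R : Type*} [CommRing R] [Nontrivial R] (k : R) :
    ∀ j, (lucasPoly k j).Monic ∧ (lucasPoly k j).natDegree = j
  | 0 => by simp [lucasPoly]
  | 1 => by simp [lucasPoly, Polynomial.monic_X]
  | j + 2 => by
    have h1 := lucasPoly_monic k (j + 1)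
    have h0 := lucasPoly_monic k j
    have hm := Polynomial.monic_X.mul h1.1
    have hd : (Polynomial.X * lucasPoly k (j + 1)).natDegree = j + 2 := by
      rw [Polynomial.monic_X.natDegree_mul h1.1, h1.2, Polynomial.natDegree_X]
      ring
    have hlt : (Polynomial.C k * lucasPoly k j).natDegree <
        (Polynomial.X * lucasPoly k (j + 1)).natDegree := by
      rw [hd]
      exact (Polynomial.natDegree_C_mul_le _ _).trans_lt (by omega)
    rw [lucasPoly]
    exact ⟨hm.sub_of_left (Polynomial.degree_lt_degree hlt),
      by rw [Polynomial.natDegree_sub_eq_left_of_natDegree_lt hlt, hd]⟩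

/-- As `a i * b i` does not depend on `i`, the same monic polynomials of degree `j` in `a i + b i`
serve all columns, so the determinant reduces to a Vandermonde one. -/
theorem det_pow_sub_pow {n : ℕ} {R : Type*} [CommRing R] [Nontrivial R] {a b : Fin n → R} {k : R}
    (hk : ∀ i, a i * b i = k) :
    (Matrix.of fun j i : Fin n => b i ^ (j + 1 : ℕ) - a i ^ (j + 1 : ℕ)).det =
      (∏ i, (b i - a i)) * vdmProd fun i => a i + b i := by
  rw [vdmProd_eq_det, Matrix.det_eval_matrixOfPolynomials_eq_det_vandermonde _
    (fun j : Fin n => lucasPoly k j) (fun j => (lucasPoly_monic k j).2)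
    (fun j => (lucasPoly_monic k j).1), ← Matrix.det_transpose, ← Matrix.det_mul_column]
  congr 1
  ext i j
  simp only [Matrix.transpose_apply, Matrix.of_apply]
  rw [← lucasPoly_eval, hk]

/-- The product of `1 - q ^ (c + 2 n - 1 - i - j)` over `0 ≤ i ≤ j < n`. -/
def staircaseProd {R : Type*} [CommRing R] (q : R) (n c : ℕ) : R :=
  (∏ i : Fin n, (1 - q ^ (c + n + n - 1 - (i + i)))) *
    pairProd (fun i j : Fin n => 1 - q ^ (c + n + n - 1 - (i + j))) Finset.univ

theorem orthoDet_pow {R : Type*} [CommRing R] [Nontrivial R] (q : R) (n c : ℕ) :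
    orthoDet (fun j : Fin n => q ^ (j + 1 : ℕ)) (c + n) =
      ((∏ i : Fin n, q ^ (i : ℕ)) * vdmProd fun i : Fin n => q ^ (i : ℕ)) *
        staircaseProd q n c := by
  have h := det_pow_sub_pow (n := n) (a := fun i => q ^ (c + n + n - 1 - i))
    (b := fun i => q ^ (i : ℕ)) (k := q ^ (c + n + n - 1)) (fun i => by
      rw [← pow_add]
      congr 1
      have := i.isLt
      omega)
  -- Base and exponent trade places: `(q^(j+1))^i = (q^i)^(j+1)`.
  have e : orthoDet (fun j : Fin n => q ^ (j + 1 : ℕ)) (c + n) =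
      (Matrix.of fun j i : Fin n => (q ^ (i : ℕ)) ^ (j + 1 : ℕ) -
        (q ^ (c + n + n - 1 - i)) ^ (j + 1 : ℕ)).det := by
    unfold orthoDet
    congr 1
    ext j i
    simp only [Matrix.of_apply, ← pow_mul]
    rw [mul_comm, mul_comm ((j : ℕ) + 1)]
  have h1 : ∏ i : Fin n, (q ^ (i : ℕ) - q ^ (c + n + n - 1 - i)) =
      (∏ i : Fin n, q ^ (i : ℕ)) * ∏ i : Fin n, (1 - q ^ (c + n + n - 1 - (i + i))) := by
    rw [← Finset.prod_mul_distrib]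
    refine Finset.prod_congr rfl fun i _ => ?_
    have : c + n + n - 1 - (i : ℕ) = i + (c + n + n - 1 - (i + i)) := by
      have := i.isLt
      omega
    rw [this, pow_add]
    ring
  have h2 : (vdmProd fun i : Fin n => q ^ (c + n + n - 1 - i) + q ^ (i : ℕ)) =
      (vdmProd fun i : Fin n => q ^ (i : ℕ)) *
        pairProd (fun i j : Fin n => 1 - q ^ (c + n + n - 1 - (i + j))) Finset.univ := by
    rw [vdmProd, vdmProd, ← pairProd_mul]
    refine pairProd_congr fun i _ j _ hij => ?_
    have hi := i.isLt
    have hj := j.isLt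
    have hij' : (i : ℕ) < j := hij
    have e1 : c + n + n - 1 - (i : ℕ) = j + (c + n + n - 1 - (i + j)) := by omega
    have e2 : c + n + n - 1 - (j : ℕ) = i + (c + n + n - 1 - (i + j)) := by omega
    rw [e1, e2, pow_add, pow_add]
    ring
  rw [e, h, h1, h2, staircaseProd]
  ring

/-- Passing from `n` to `n + 1`, the pairs containing 0 form the new factor; the others, with both
indices lowered by 1, keep their exponents. -/
theorem staircaseProd_eq {R : Type*} [CommRing R] (q : R) (c n : ℕ) :
    staircaseProd q n c = ∏ i ∈ Finset.Icc 1 n, ∏ k ∈ Finset.range i, (1 - q ^ (c + i + k)) := by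
  induction n with
  | zero => simp [staircaseProd, pairProd]
  | succ n ih =>
    rw [Finset.prod_Icc_succ_top (Nat.succ_le_succ (Nat.zero_le n)), ← ih, staircaseProd,
      pairProd_eq_erase _ (Finset.mem_univ 0), univ_erase_eq_map, pairProd_map, Finset.prod_map,
      Fin.prod_univ_succ, staircaseProd, ← Finset.prod_range_reflect, Finset.prod_range,
      Fin.prod_univ_succ]
    have e1 : ∀ i : Fin n, (if 0 < (Fin.succAboveOrderEmb (0 : Fin (n + 1))).toEmbedding i then
        1 - q ^ (c + (n + 1) + (n + 1) - 1 - (((0 : Fin (n + 1)) : ℕ) +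
          ((Fin.succAboveOrderEmb (0 : Fin (n + 1))).toEmbedding i : ℕ))) else
        1 - q ^ (c + (n + 1) + (n + 1) - 1 - (((Fin.succAboveOrderEmb (0 : Fin (n + 1))).toEmbedding
          i : ℕ) + ((0 : Fin (n + 1)) : ℕ)))) = 1 - q ^ (c + (n + 1) + (n + 1 - 1 - i.succ)) :=
      fun i => by
        have h : (Fin.succAboveOrderEmb (0 : Fin (n + 1))).toEmbedding i = i.succ := rfl
        rw [h, if_pos (Fin.succ_pos i), Fin.val_succ, Fin.val_zero]
        congr 2
        have := i.isLt
        omega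
    have e2 : ∀ i j : Fin n, c + (n + 1) + (n + 1) - 1 -
        ((Fin.succAboveOrderEmb (0 : Fin (n + 1)) i : ℕ) +
          (Fin.succAboveOrderEmb (0 : Fin (n + 1)) j : ℕ)) = c + n + n - 1 - (i + j) :=
      fun i j => by
        have h : ∀ i, (Fin.succAboveOrderEmb (0 : Fin (n + 1))) i = i.succ := fun _ => rfl
        rw [h, h, Fin.val_succ, Fin.val_succ]
        omega
    have e3 : ∀ i : Fin n, c + (n + 1) + (n + 1) - 1 - ((i.succ : ℕ) + (i.succ : ℕ)) =
        c + n + n - 1 - (i + i) := fun i => by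
      rw [Fin.val_succ]
      omega
    have e4 : c + (n + 1) + (n + 1) - 1 - (((0 : Fin (n + 1)) : ℕ) + ((0 : Fin (n + 1)) : ℕ)) =
        c + (n + 1) + (n + 1 - 1 - ((0 : Fin (n + 1)) : ℕ)) := by
      rw [Fin.val_zero]
      omega
    simp only [e1, e2, e3, e4]
    ring

/-- Numerator and denominator of the `i`-th quotient have `i` brackets each, so the powers of `1 -
q` cancel. -/
theorem prod_qRising_div {K : Type*} [Field K] {q : K} (hq : ∀ m, m ≠ 0 → q ^ m ≠ 1) (n c : ℕ) :
    ∏ i ∈ Finset.Icc 1 n, qRising q (c + i) i / qRising q i i =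
      staircaseProd q n c / staircaseProd q n 0 := by
  have h1 : 1 - q ≠ 0 := sub_ne_zero.2 fun h => hq 1 one_ne_zero (by rw [pow_one, ← h])
  have hb : ∀ m, qBracket q m = (1 - q ^ m) / (1 - q) := fun m => by
    rw [eq_div_iff h1, qBracket, geom_sum_mul_neg]
  rw [staircaseProd_eq, staircaseProd_eq, ← Finset.prod_div_distrib]
  refine Finset.prod_congr rfl fun i _ => ?_
  simp only [qRising, hb, Finset.prod_div_distrib, Finset.prod_const, zero_add]
  rw [div_div_div_cancel_right₀ (pow_ne_zero _ h1)]

theorem staircaseProd_ne_zero {K : Type*} [Field K] {q : K} (hq : ∀ m, m ≠ 0 → q ^ m ≠ 1)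
    (n c : ℕ) : staircaseProd q n c ≠ 0 := by
  rw [staircaseProd_eq]
  refine Finset.prod_ne_zero_iff.2 fun i hi => Finset.prod_ne_zero_iff.2 fun k _ => ?_
  have := (Finset.mem_Icc.1 hi).1
  exact sub_ne_zero.2 (hq _ (by omega)).symm

theorem generic_pow {K : Type*} [Field K] {q : K} (h0 : q ≠ 0) (hq : ∀ m, m ≠ 0 → q ^ m ≠ 1)
    (n : ℕ) : Generic fun i : Fin n => q ^ (i + 1 : ℕ) where
  inj i j h := by
    by_contra hij
    have : ∀ a b : ℕ, a < b → q ^ a ≠ q ^ b := fun a b hab h => by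
      have e : b = a + (b - a) := by omega
      rw [e, pow_add] at h
      exact hq (b - a) (by omega) (mul_left_cancel₀ (pow_ne_zero a h0) (by rw [← h, mul_one]))
    rcases lt_or_gt_of_ne (fun h => hij (Fin.ext h) : (i : ℕ) ≠ j) with h' | h'
    · exact this _ _ (Nat.succ_lt_succ h') h
    · exact this _ _ (Nat.succ_lt_succ h') h.symm
  ne_zero i := pow_ne_zero _ h0
  mul_ne_one i j := by
    rw [← pow_add]
    exact hq _ (by omega)

theorem RatFunc.X_pow_ne_one {K : Type*} [Field K] {m : ℕ} (hm : m ≠ 0) :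
    (RatFunc.X : RatFunc K) ^ m ≠ 1 := by
  intro h
  rw [← RatFunc.algebraMap_X, ← map_pow, ← map_one (algebraMap (Polynomial K) (RatFunc K))] at h
  have := congrArg Polynomial.natDegree (RatFunc.algebraMap_injective K h)
  rw [Polynomial.natDegree_X_pow, Polynomial.natDegree_one] at this
  exact hm this

/-! ### Young diagrams as strictly increasing sequences. -/

namespace YoungDiagram

theorem ext_rowLen {μ ν : YoungDiagram} (h : ∀ i, μ.rowLen i = ν.rowLen i) : μ = ν := by
  ext ⟨i, j⟩
  rw [mem_cells, mem_cells, mem_iff_lt_rowLen, mem_iff_lt_rowLen, h]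

/-- The strictly increasing sequence `λ_n, λ_{n-1} + 1, …, λ_1 + n - 1`. -/
def rowCode (n : ℕ) (μ : YoungDiagram) (j : Fin n) : ℕ :=
  μ.rowLen (n - 1 - j) + j

theorem rowCode_strictMono (n : ℕ) (μ : YoungDiagram) : StrictMono (μ.rowCode n) := by
  intro i j hij
  exact add_lt_add_of_le_of_lt (μ.rowLen_anti _ _ (Nat.sub_le_sub_left hij.le _)) hij

theorem rowLen_eq_rowCode_sub (μ : YoungDiagram) {n i : ℕ} (hi : i < n) :
    μ.rowLen i = μ.rowCode n ⟨n - 1 - i, by omega⟩ - (n - 1 - i) := by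
  rw [rowCode, Nat.add_sub_cancel]
  congr 1
  simp only
  omega

theorem rowCode_injective {n : ℕ} {μ ν : YoungDiagram} (hμ : ∀ i, n ≤ i → μ.rowLen i = 0)
    (hν : ∀ i, n ≤ i → ν.rowLen i = 0) (h : μ.rowCode n = ν.rowCode n) : μ = ν := by
  refine ext_rowLen fun i => ?_
  rcases lt_or_ge i n with hi | hi
  · rw [rowLen_eq_rowCode_sub μ hi, rowLen_eq_rowCode_sub ν hi, h]
  · rw [hμ i hi, hν i hi]

theorem exists_rowLen_eq {n : ℕ} {f : ℕ → ℕ} (hf : Antitone f) (h0 : ∀ i, n ≤ i → f i = 0) :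
    ∃ μ : YoungDiagram, ∀ i, μ.rowLen i = f i := by
  let μ : YoungDiagram :=
    { cells := (Finset.range n ×ˢ Finset.range (f 0)).filter fun p => p.2 < f p.1
      isLowerSet := fun a b hba h => by
        rw [Finset.mem_coe, Finset.mem_filter, Finset.mem_product, Finset.mem_range,
          Finset.mem_range] at h ⊢
        have := hf hba.1
        have := hba.1
        have := hba.2
        omega }
  have hmem : ∀ i j, (i, j) ∈ μ ↔ j < f i := fun i j => by
    rw [← mem_cells]
    simp only [μ, Finset.mem_filter, Finset.mem_product, Finset.mem_range, and_iff_right_iff_imp]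
    intro h
    refine ⟨?_, h.trans_le (hf (Nat.zero_le i))⟩
    by_contra hi
    rw [h0 i (not_lt.1 hi)] at h
    exact Nat.not_lt_zero _ h
  refine ⟨μ, fun i => ?_⟩
  have : ∀ j, j < μ.rowLen i ↔ j < f i := fun j => by rw [← mem_iff_lt_rowLen, hmem]
  exact le_antisymm (not_lt.1 fun h => lt_irrefl _ ((this _).1 h))
    (not_lt.1 fun h => lt_irrefl _ ((this _).2 h))

theorem exists_rowCode_eq {n : ℕ} {l : Fin n → ℕ} (hl : StrictMono l) :
    ∃ μ : YoungDiagram, (∀ i, n ≤ i → μ.rowLen i = 0) ∧ μ.rowCode n = l := by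
  -- These gaps make `l j - j` weakly increasing, so that reversing it gives row lengths.
  have hstep : ∀ d : ℕ, ∀ i j : Fin n, (j : ℕ) = i + d → l i + d ≤ l j := by
    intro d
    induction d with
    | zero =>
      intro i j h
      have : j = i := Fin.ext h
      rw [this, add_zero]
    | succ d ih =>
      intro i j h
      have h1 := ih i ⟨i + d, by omega⟩ rfl
      have h2 : l ⟨i + d, by omega⟩ < l j := hl (Fin.lt_def.2 (by simp only; omega))
      omega
  have hge : ∀ j : Fin n, (j : ℕ) ≤ l j := fun j => by
    have := hstep j ⟨0, j.pos⟩ j (by simp)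
    omega
  obtain ⟨μ, hμ⟩ := exists_rowLen_eq (n := n)
    (f := fun i => if h : i < n then l ⟨n - 1 - i, by omega⟩ - (n - 1 - i) else 0)
    (fun i j hij => by
      by_cases hj : j < n
      · have hi : i < n := hij.trans_lt hj
        simp only [hi, hj, dif_pos]
        have := hstep (j - i) ⟨n - 1 - j, by omega⟩ ⟨n - 1 - i, by omega⟩ (by simp only; omega)
        omega
      · simp [hj])
    (fun i hi => by simp [hi.not_gt])
  refine ⟨μ, fun i hi => by rw [hμ]; simp [hi.not_gt], funext fun j => ?_⟩
  have hj : n - 1 - (j : ℕ) < n := by omega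
  have hj' : n - 1 - (n - 1 - (j : ℕ)) = j := by omega
  rw [rowCode, hμ, dif_pos hj]
  simp only [hj']
  exact Nat.sub_add_cancel (hge j)

theorem card_add_eq_sum_rowCode {n : ℕ} {μ : YoungDiagram} (hμ : ∀ i, n ≤ i → μ.rowLen i = 0) :
    μ.cells.card + ∑ j : Fin n, (j : ℕ) = ∑ j, μ.rowCode n j := by
  have h1 : μ.cells.card = ∑ i ∈ Finset.range n, μ.rowLen i := by
    rw [Finset.card_eq_sum_card_fiberwise (f := Prod.fst) (t := Finset.range n)]
    · refine Finset.sum_congr rfl fun i _ => ?_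
      rw [rowLen_eq_card]
      rfl
    · rintro ⟨i, j⟩ hij
      rw [Finset.mem_coe, mem_cells, mem_iff_lt_rowLen] at hij
      by_contra h
      rw [hμ i (by simpa using h)] at hij
      exact Nat.not_lt_zero _ hij
  rw [h1, ← Finset.sum_range_reflect, Finset.sum_range, ← Finset.sum_add_distrib]
  rfl

end YoungDiagram

/-! ### Peeling off the parts equal to 1. -/

namespace StrictPlanePartition

theorem entry_le_of_le (π : StrictPlanePartition) {i i' j j' : ℕ} (hi : i' ≤ i) (hj : j' ≤ j)
    (h : (i, j) ∈ π.shape) : π.entry i j ≤ π.entry i' j' := by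
  have h1 : π.entry i j ≤ π.entry i j' := by
    rcases hj.eq_or_lt with rfl | hj
    · exact le_rfl
    · exact π.row_weak hj h
  have h2 : π.entry i j' ≤ π.entry i' j' := by
    rcases hi.eq_or_lt with rfl | hi
    · exact le_rfl
    · exact (π.col_strict hi (π.shape.up_left_mem le_rfl hj h)).le
  exact h1.trans h2

theorem PartsIn.entry_add_le {π : StrictPlanePartition} {n : ℕ} (hπ : π.PartsIn n) {j : ℕ} :
    ∀ {i : ℕ}, (i, j) ∈ π.shape → π.entry i j + i ≤ n
  | 0, h => (hπ 0 j h).2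
  | i + 1, h => by
    have h1 := PartsIn.entry_add_le hπ (π.shape.up_left_mem (Nat.le_succ i) le_rfl h)
    have h2 := π.col_strict (Nat.lt_add_one i) h
    omega

theorem PartsIn.rowLen_eq_zero {π : StrictPlanePartition} {n : ℕ} (hπ : π.PartsIn n) (i : ℕ)
    (hi : n ≤ i) : π.shape.rowLen i = 0 := by
  by_contra h
  have hm : (i, 0) ∈ π.shape := YoungDiagram.mem_iff_lt_rowLen.2 (Nat.pos_of_ne_zero h)
  have h1 := hπ.entry_add_le hm
  have h2 := (hπ i 0 hm).1
  omega

/-- The cells with part at least `2`. -/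
def decrShape (π : StrictPlanePartition) : YoungDiagram where
  cells := π.shape.cells.filter fun p => 2 ≤ π.entry p.1 p.2
  isLowerSet a b hba h := by
    rw [Finset.mem_coe, Finset.mem_filter, YoungDiagram.mem_cells] at h ⊢
    exact ⟨π.shape.up_left_mem hba.1 hba.2 h.1, h.2.trans (π.entry_le_of_le hba.1 hba.2 h.1)⟩

theorem mem_decrShape {π : StrictPlanePartition} {i j : ℕ} :
    (i, j) ∈ π.decrShape ↔ (i, j) ∈ π.shape ∧ 2 ≤ π.entry i j := by
  rw [← YoungDiagram.mem_cells, decrShape, Finset.mem_filter, YoungDiagram.mem_cells]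

/-- Subtract `1` from all parts, and drop the parts that become `0`. -/
def decr (π : StrictPlanePartition) : StrictPlanePartition where
  shape := π.decrShape
  entry i j := π.entry i j - 1
  row_weak hj h := Nat.sub_le_sub_right (π.row_weak hj (mem_decrShape.1 h).1) 1
  col_strict hi h := by
    have h1 := π.col_strict hi (mem_decrShape.1 h).1
    have h2 := (mem_decrShape.1 h).2
    omega
  zeros {i j} h := by
    by_cases hm : (i, j) ∈ π.shape
    · have : ¬ 2 ≤ π.entry i j := fun h2 => h (mem_decrShape.2 ⟨hm, h2⟩)
      omega
    · rw [π.zeros hm]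

theorem mem_decr_shape {π : StrictPlanePartition} {i j : ℕ} :
    (i, j) ∈ π.decr.shape ↔ (i, j) ∈ π.shape ∧ 2 ≤ π.entry i j :=
  mem_decrShape

theorem PartsIn.decr {π : StrictPlanePartition} {n : ℕ} (hπ : π.PartsIn (n + 1)) :
    π.decr.PartsIn n := by
  intro i j h
  rw [mem_decr_shape] at h
  have := (hπ i j h.1).2
  change 1 ≤ π.entry i j - 1 ∧ π.entry i j - 1 ≤ n
  omega

theorem decr_rowLen_le (π : StrictPlanePartition) (i : ℕ) :
    π.decr.shape.rowLen i ≤ π.shape.rowLen i := by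
  by_contra! h
  have := YoungDiagram.mem_iff_lt_rowLen.1 (mem_decr_shape.1 (YoungDiagram.mem_iff_lt_rowLen.2 h)).1
  exact lt_irrefl _ this

theorem PartsIn.rowLen_succ_le {π : StrictPlanePartition} {n : ℕ} (hπ : π.PartsIn n) (i : ℕ) :
    π.shape.rowLen (i + 1) ≤ π.decr.shape.rowLen i := by
  by_contra! h
  have h1 := YoungDiagram.mem_iff_lt_rowLen.2 h
  have h2 := π.col_strict (Nat.lt_add_one i) h1
  have h3 := (hπ _ _ h1).1
  have h4 : (i, π.decr.shape.rowLen i) ∈ π.decr.shape :=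
    mem_decr_shape.2 ⟨π.shape.up_left_mem (Nat.le_succ i) le_rfl h1, by omega⟩
  exact lt_irrefl _ (YoungDiagram.mem_iff_lt_rowLen.1 h4)

theorem PartsIn.norm_eq {π : StrictPlanePartition} {n : ℕ} (hπ : π.PartsIn n) :
    π.norm = π.shape.cells.card + π.decr.norm := by
  have h1 : π.decr.norm = ∑ x ∈ π.shape.cells, (π.entry x.1 x.2 - 1) := by
    refine Finset.sum_subset (Finset.filter_subset _ _) fun x hx hx' => ?_
    have : ¬ 2 ≤ π.entry x.1 x.2 := fun h => hx' (Finset.mem_filter.2 ⟨hx, h⟩)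
    change π.entry x.1 x.2 - 1 = 0
    omega
  rw [h1, Finset.card_eq_sum_ones, ← Finset.sum_add_distrib]
  refine Finset.sum_congr rfl fun x hx => ?_
  have := (hπ x.1 x.2 hx).1
  omega

theorem PartsIn.eq_of_decr_eq {π π' : StrictPlanePartition} {n : ℕ} (hπ : π.PartsIn n)
    (hπ' : π'.PartsIn n) (hs : π.shape = π'.shape) (hd : π.decr = π'.decr) : π = π' := by
  refine StrictPlanePartition.ext hs (funext fun i => funext fun j => ?_)
  by_cases h : (i, j) ∈ π.shape
  · have h1 := (hπ i j h).1
    have h2 := (hπ' i j (hs ▸ h)).1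
    have h3 : π.entry i j - 1 = π'.entry i j - 1 := congrFun (congrFun (congrArg entry hd) i) j
    omega
  · rw [π.zeros h, π'.zeros (hs ▸ h)]

/-- Adding 1 throughout `μ` puts 1's on the new cells, where `π` has entry 0. Columns stay strict
because every cell of `μ` above another one already belongs to `π.shape`. -/
theorem exists_decr_eq {π : StrictPlanePartition} {n : ℕ} (hπ : π.PartsIn n) {μ : YoungDiagram}
    (h1 : ∀ i, π.shape.rowLen i ≤ μ.rowLen i) (h2 : ∀ i, μ.rowLen (i + 1) ≤ π.shape.rowLen i) :
    ∃ π' : StrictPlanePartition, π'.PartsIn (n + 1) ∧ π'.shape = μ ∧ π'.decr = π := by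
  have hsub : ∀ {i j}, (i, j) ∈ π.shape → (i, j) ∈ μ := fun {i j} h => by
    rw [YoungDiagram.mem_iff_lt_rowLen] at h ⊢
    exact h.trans_le (h1 i)
  have hstrip : ∀ {i i' j}, i' < i → (i, j) ∈ μ → (i', j) ∈ π.shape := fun {i i' j} hi h => by
    have h := μ.up_left_mem (i1 := i' + 1) hi le_rfl h
    rw [YoungDiagram.mem_iff_lt_rowLen] at h ⊢
    exact h.trans_le (h2 i')
  classical
  let π' : StrictPlanePartition :=
    { shape := μ
      entry := fun i j => if (i, j) ∈ μ then π.entry i j + 1 else 0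
      row_weak := fun {i j₁ j₂} hj h => by
        rw [if_pos h, if_pos (μ.up_left_mem le_rfl hj.le h)]
        by_cases hm : (i, j₂) ∈ π.shape
        · exact Nat.succ_le_succ (π.row_weak hj hm)
        · rw [π.zeros hm]
          omega
      col_strict := fun {i₁ i₂ j} hi h => by
        rw [if_pos h, if_pos (μ.up_left_mem hi.le le_rfl h)]
        by_cases hm : (i₂, j) ∈ π.shape
        · exact Nat.succ_lt_succ (π.col_strict hi hm)
        · rw [π.zeros hm]
          have := (hπ _ _ (hstrip hi h)).1
          omega
      zeros := fun h => if_neg h }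
  have he : ∀ {i j}, (i, j) ∈ μ → π'.entry i j = π.entry i j + 1 := fun h => if_pos h
  have he' : ∀ {i j}, (i, j) ∉ μ → π'.entry i j = 0 := fun h => if_neg h
  refine ⟨π', fun i j h => ?_, rfl, StrictPlanePartition.ext ?_ ?_⟩
  · rw [he h]
    by_cases hm : (i, j) ∈ π.shape
    · have := hπ i j hm
      omega
    · rw [π.zeros hm]
      omega
  · ext ⟨i, j⟩
    rw [YoungDiagram.mem_cells, YoungDiagram.mem_cells, mem_decr_shape]
    constructor
    · rintro ⟨h, h'⟩
      rw [he h] at h'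
      by_contra hm
      rw [π.zeros hm] at h'
      omega
    · intro h
      refine ⟨hsub h, ?_⟩
      rw [he (hsub h)]
      have := (hπ i j h).1
      omega
  · funext i j
    change π'.entry i j - 1 = π.entry i j
    by_cases h : (i, j) ∈ μ
    · rw [he h, Nat.add_sub_cancel]
    · rw [he' h, π.zeros fun hm => h (hsub hm)]

/-! ### Generating functions of given shape and the final evaluation. -/

/-- The strict plane partitions with parts in `{1, …, n}` whose shape is encoded by `l`. -/
def ofCode (n : ℕ) (l : Fin n → ℕ) : Set StrictPlanePartition :=
  {π | π.PartsIn n ∧ π.shape.rowCode n = l}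

theorem rowCode_mem_piFinset_iff {n : ℕ} {μ ν : YoungDiagram} :
    (ν.rowCode n ∈ Fintype.piFinset fun j : Fin n =>
      Finset.Ico (μ.rowCode (n + 1) j.castSucc) (μ.rowCode (n + 1) j.succ)) ↔
    (∀ i < n, ν.rowLen i ≤ μ.rowLen i) ∧ ∀ i < n, μ.rowLen (i + 1) ≤ ν.rowLen i := by
  have h1 : ∀ i j : ℕ, i < n → j = n - 1 - i → n - 1 - j = i ∧ n + 1 - 1 - j = i + 1 ∧
      n + 1 - 1 - (j + 1) = i := by omega
  simp only [Fintype.mem_piFinset, Finset.mem_Ico, YoungDiagram.rowCode, Fin.val_castSucc,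
    Fin.val_succ]
  constructor
  · intro h
    refine ⟨fun i hi => ?_, fun i hi => ?_⟩ <;>
    · obtain ⟨e1, e2, e3⟩ := h1 i _ hi rfl
      have := h ⟨n - 1 - i, by omega⟩
      simp only [e1, e2, e3] at this
      omega
  · rintro ⟨h2, h3⟩ j
    obtain ⟨e1, e2, e3⟩ := h1 (n - 1 - j) j (by omega) (by omega)
    have h4 := h2 (n - 1 - j) (by omega)
    have h5 := h3 (n - 1 - j) (by omega)
    rw [e2, e3]
    omega

theorem bijOn_decr {n : ℕ} {l : Fin (n + 1) → ℕ} (hl : StrictMono l) :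
    Set.BijOn decr (ofCode (n + 1) l)
      (⋃ m ∈ Fintype.piFinset fun j : Fin n => Finset.Ico (l j.castSucc) (l j.succ),
        ofCode n m) := by
  obtain ⟨μ, hμ0, rfl⟩ := YoungDiagram.exists_rowCode_eq hl
  have hshape : ∀ {π}, π ∈ ofCode (n + 1) (μ.rowCode (n + 1)) → π.shape = μ := fun {π} h =>
    YoungDiagram.rowCode_injective h.1.rowLen_eq_zero hμ0 h.2
  refine ⟨fun π h => ?_, fun π h π' h' hd => ?_, fun π h => ?_⟩
  · refine Set.mem_biUnion (x := π.decr.shape.rowCode n) ?_ ⟨h.1.decr, rfl⟩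
    refine rowCode_mem_piFinset_iff.2 ?_
    rw [← hshape h]
    exact ⟨fun i _ => π.decr_rowLen_le i, fun i _ => h.1.rowLen_succ_le i⟩
  · exact h.1.eq_of_decr_eq h'.1 ((hshape h).trans (hshape h').symm) hd
  · obtain ⟨m, hm, hπ, rfl⟩ := Set.mem_iUnion₂.1 h
    have := rowCode_mem_piFinset_iff.1 hm
    obtain ⟨π', h1, h2, h3⟩ := exists_decr_eq hπ (μ := μ)
      (fun i => by
        rcases lt_or_ge i n with hi | hi
        · exact this.1 i hi
        · rw [hπ.rowLen_eq_zero i hi]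
          exact Nat.zero_le _)
      (fun i => by
        rcases lt_or_ge i n with hi | hi
        · exact this.2 i hi
        · rw [hμ0 (i + 1) (Nat.succ_le_succ hi)]
          exact Nat.zero_le _)
    exact ⟨π', ⟨h1, by rw [h2]⟩, h3⟩

theorem strictMono_of_mem_piFinset {n : ℕ} {l : Fin (n + 1) → ℕ} {m : Fin n → ℕ}
    (hm : m ∈ Fintype.piFinset fun j : Fin n => Finset.Ico (l j.castSucc) (l j.succ)) :
    StrictMono m := by
  rcases n with _ | n
  · exact fun i => i.elim0
  · refine Fin.strictMono_iff_lt_succ.2 fun i => ?_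
    rw [Fintype.mem_piFinset] at hm
    have h1 := (Finset.mem_Ico.1 (hm i.castSucc)).2
    have h2 := (Finset.mem_Ico.1 (hm i.succ)).1
    rw [← Fin.succ_castSucc] at h2
    exact h1.trans_le h2

/-- The empty strict plane partition. -/
def empty : StrictPlanePartition where
  shape := ⊥
  entry _ _ := 0
  row_weak _ _ := le_rfl
  col_strict _ h := absurd h (YoungDiagram.notMem_bot _)
  zeros _ := rfl

theorem eq_empty_of_forall_notMem {π : StrictPlanePartition} (h : ∀ i j, (i, j) ∉ π.shape) :
    π = empty := by
  refine StrictPlanePartition.ext ?_ (funext fun i => funext fun j => π.zeros (h i j))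
  ext ⟨i, j⟩
  exact iff_of_false (h i j) (YoungDiagram.notMem_bot _)

theorem empty_partsIn (n : ℕ) : empty.PartsIn n :=
  fun _ _ h => absurd h (YoungDiagram.notMem_bot _)

theorem norm_empty : empty.norm = 0 := rfl

theorem ofCode_zero (l : Fin 0 → ℕ) : ofCode 0 l = {empty} := by
  ext π
  rw [Set.mem_singleton_iff]
  constructor
  · rintro ⟨h, _⟩
    refine eq_empty_of_forall_notMem fun i j hij => ?_
    have := h i j hij
    omega
  · rintro rfl
    exact ⟨empty_partsIn 0, Subsingleton.elim _ _⟩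

theorem bounded_zero (n : ℕ) : bounded n 0 = {empty} := by
  ext π
  rw [Set.mem_singleton_iff]
  constructor
  · rintro ⟨_, h⟩
    refine eq_empty_of_forall_notMem fun i j hij => ?_
    have := YoungDiagram.mem_iff_lt_rowLen.1 (π.shape.up_left_mem (Nat.zero_le i) le_rfl hij)
    exact absurd (this.trans_le h) (Nat.not_lt_zero _)
  · rintro rfl
    refine ⟨empty_partsIn n, not_lt.1 fun h => ?_⟩
    exact YoungDiagram.notMem_bot _ (YoungDiagram.mem_iff_lt_rowLen.2 h)

theorem finite_ofCode : ∀ {n : ℕ} {l : Fin n → ℕ}, StrictMono l → (ofCode n l).Finite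
  | 0, l, _ => by
    rw [ofCode_zero]
    exact Set.finite_singleton _
  | n + 1, l, hl => by
    refine (bijOn_decr hl).finite_iff_finite.2 ?_
    exact Set.Finite.biUnion (Finset.finite_toSet _) fun m hm =>
      finite_ofCode (strictMono_of_mem_piFinset hm)

theorem pairwise_disjoint_ofCode (n : ℕ) (s : Set (Fin n → ℕ)) :
    s.PairwiseDisjoint (ofCode n) := by
  intro l _ m _ hlm
  refine Set.disjoint_left.2 fun π h h' => hlm (h.2.symm.trans h'.2)

theorem finsum_biUnion_ofCode {M : Type*} [AddCommMonoid M] {n : ℕ} {s : Finset (Fin n → ℕ)}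
    (hs : ∀ l ∈ s, StrictMono l) (f : StrictPlanePartition → M) :
    ∑ᶠ π ∈ ⋃ l ∈ s, ofCode n l, f π = ∑ l ∈ s, ∑ᶠ π ∈ ofCode n l, f π := by
  have := finsum_mem_biUnion (f := f) (pairwise_disjoint_ofCode n (s : Set (Fin n → ℕ)))
    s.finite_toSet fun l hl => finite_ofCode (hs l hl)
  rw [finsum_mem_coe_finset] at this
  exact this

/-- The factor `q ^ ∑ j` compensates for the staircase added in `rowCode`, turning the size of the
shape into `∑ l j`. -/
theorem finsum_ofCode_succ {R : Type*} [CommRing R] (q : R) {n : ℕ} {l : Fin (n + 1) → ℕ}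
    (hl : StrictMono l) :
    q ^ (∑ j : Fin (n + 1), (j : ℕ)) * ∑ᶠ π ∈ ofCode (n + 1) l, q ^ π.norm =
      q ^ (∑ j, l j) *
        ∑ m ∈ Fintype.piFinset fun j : Fin n => Finset.Ico (l j.castSucc) (l j.succ),
          ∑ᶠ π ∈ ofCode n m, q ^ π.norm := by
  rw [← finsum_biUnion_ofCode (fun m hm => strictMono_of_mem_piFinset hm),
    mul_finsum_mem' _ _ (finite_ofCode hl), mul_finsum_mem' _ _
      ((bijOn_decr hl).finite_iff_finite.1 (finite_ofCode hl))]
  refine finsum_mem_eq_of_bijOn decr (bijOn_decr hl) fun π h => ?_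
  rw [h.1.norm_eq, ← pow_add, ← pow_add, ← h.2,
    ← YoungDiagram.card_add_eq_sum_rowCode h.1.rowLen_eq_zero]
  congr 1
  omega

/-- The ratio between alternants and generating functions of strict plane partitions of given
shape. -/
def alternantFactor {R : Type*} [CommRing R] (q : R) : ℕ → R
  | 0 => 1
  | n + 1 => q ^ (∑ j : Fin (n + 1), (j : ℕ)) * (∏ i : Fin n, (q ^ (i + 1 : ℕ) - 1)) *
      alternantFactor q n

theorem alternantFactor_mul_finsum {R : Type*} [CommRing R] (q : R) :
    ∀ {n : ℕ} {l : Fin n → ℕ}, StrictMono l →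
      alternantFactor q n * ∑ᶠ π ∈ ofCode n l, q ^ π.norm =
        alternant (fun i : Fin n => q ^ (i + 1 : ℕ)) l
  | 0, l, _ => by
    rw [ofCode_zero, finsum_mem_singleton, norm_empty]
    simp [alternantFactor, alternant]
  | n + 1, l, hl => by
    rw [alternant_pow_succ q hl.monotone, ← Finset.sum_congr rfl fun m hm =>
      alternantFactor_mul_finsum q (strictMono_of_mem_piFinset hm), ← Finset.mul_sum,
      alternantFactor]
    have := finsum_ofCode_succ q hl
    linear_combination ((∏ i : Fin n, (q ^ (i + 1 : ℕ) - 1)) * alternantFactor q n) * this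

theorem bounded_eq_biUnion (n c : ℕ) : bounded n c = ⋃ l ∈ strictSeqs n (c + n), ofCode n l := by
  ext π
  rw [Set.mem_iUnion₂]
  constructor
  · rintro ⟨h1, h2⟩
    refine ⟨π.shape.rowCode n, mem_strictSeqs.2 ⟨fun j => ?_, π.shape.rowCode_strictMono n⟩, h1, rfl⟩
    have h3 : π.shape.rowLen (n - 1 - j) ≤ c := (π.shape.rowLen_anti _ _ (Nat.zero_le _)).trans h2
    exact add_lt_add_of_le_of_lt h3 j.isLt
  · rintro ⟨l, hl, h1, rfl⟩
    refine ⟨h1, ?_⟩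
    rcases n with _ | n
    · exact (h1.rowLen_eq_zero 0 le_rfl).trans_le (Nat.zero_le c)
    · have := (mem_strictSeqs.1 hl).1 (Fin.last n)
      rw [YoungDiagram.rowCode, Fin.val_last, Nat.add_sub_cancel, Nat.sub_self] at this
      change π.shape.rowLen 0 ≤ c
      omega

theorem finite_bounded (n c : ℕ) : (bounded n c).Finite := by
  rw [bounded_eq_biUnion]
  exact Set.Finite.biUnion (Finset.finite_toSet _) fun l hl =>
    finite_ofCode (mem_strictSeqs.1 hl).2

theorem alternantFactor_mul_finsum_bounded {R : Type*} [CommRing R] (q : R) (n c : ℕ) :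
    alternantFactor q n * ∑ᶠ π ∈ bounded n c, q ^ π.norm =
      alternantSum (fun i : Fin n => q ^ (i + 1 : ℕ)) (c + n) := by
  rw [bounded_eq_biUnion, finsum_biUnion_ofCode (fun l hl => (mem_strictSeqs.1 hl).2),
    Finset.mul_sum, alternantSum]
  exact Finset.sum_congr rfl fun l hl => alternantFactor_mul_finsum q (mem_strictSeqs.1 hl).2

/-- The generating function of the strict plane partitions with parts in `{1, …, n}` and at most
`c` columns, at any `q` that is neither zero nor a root of unity. -/
theorem finsum_bounded_eq {K : Type*} [Field K] {q : K} (h0 : q ≠ 0)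
    (hq : ∀ m, m ≠ 0 → q ^ m ≠ 1) (n c : ℕ) :
    ∑ᶠ π ∈ bounded n c, q ^ π.norm = staircaseProd q n c / staircaseProd q n 0 := by
  have hx := generic_pow h0 hq n
  have key : ∀ c, alternantFactor q n * (∑ᶠ π ∈ bounded n c, q ^ π.norm) *
      littlewoodKernel (fun i : Fin n => q ^ (i + 1 : ℕ)) Finset.univ =
      ((∏ i : Fin n, q ^ (i : ℕ)) * vdmProd fun i : Fin n => q ^ (i : ℕ)) *
        staircaseProd q n c := fun c => by
    rw [alternantFactor_mul_finsum_bounded, alternantSum_mul_littlewoodKernel hx, orthoDet_pow]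
  -- The case `c = 0` expresses the unknown product of `alternantFactor` and kernel through
  -- `staircaseProd q n 0`.
  have h1 := key 0
  rw [bounded_zero, finsum_mem_singleton, norm_empty, pow_zero, mul_one] at h1
  have hC : (∏ i : Fin n, q ^ (i : ℕ)) * (vdmProd fun i : Fin n => q ^ (i : ℕ)) ≠ 0 := by
    refine mul_ne_zero (Finset.prod_ne_zero_iff.2 fun i _ => pow_ne_zero _ h0)
      (vdmProd_ne_zero fun i j h => hx.inj ?_)
    simpa only [pow_succ] using congrArg (· * q) h
  have hP := staircaseProd_ne_zero hq n 0
  rw [eq_div_iff hP]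
  refine mul_left_cancel₀ hC ?_
  rw [← key c, ← mul_left_comm, ← h1]
  ring

end StrictPlanePartition

theorem mainTheorem3 (n c : ℕ) :
    (StrictPlanePartition.bounded n c).Finite ∧
      ∑ᶠ π ∈ StrictPlanePartition.bounded n c, (RatFunc.X : RatFunc ℚ) ^ π.norm =
        ∏ i ∈ Finset.Icc 1 n,
          qRising (RatFunc.X : RatFunc ℚ) (c + i) i / qRising (RatFunc.X : RatFunc ℚ) i i := by
  have hq : ∀ m, m ≠ 0 → (RatFunc.X : RatFunc ℚ) ^ m ≠ 1 := fun _ => RatFunc.X_pow_ne_one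
  exact ⟨StrictPlanePartition.finite_bounded n c,
    (StrictPlanePartition.finsum_bounded_eq RatFunc.X_ne_zero hq n c).trans
      (prod_qRising_div hq n c).symm⟩
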